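/- Let $\mathcal H$ be an infinite-dimensional complex Hilbert space and let $m,p,q$ be positive integers. For an $m$-tuple $\mathbf B=(B_1,\dots,B_m)$ of bounded linear operators on $\mathcal H$, let $\Lambda_{p,q}(\mathbf B)\subseteq \mathbf M_q^m$ (where $\mathbf M_q$ denotes the $q\times q$ complex matrices) be the set of all $(C_1,\dots,C_m)\in\mathbf M_q^m$ for which there is a linear map $X:\mathbb C^{pq}\to\mathcal H$ with $X^*X=I_{pq}$ and $X^*B_jX=I_p\otimes C_j$ for $j=1,\dots,m$. Let $$\Lambda^{ess}_{p,q}(\mathbf B)=\bigcap\{\mathbf{cl}(\Lambda_{p,q}(B_1+F_1,\dots,B_m+F_m)) : F_1,\dots,F_m \text{ bounded finite rank operators on } \mathcal H\},$$ where $\mathbf{cl}$ denotes closure in $\mathbf M_q^m$. Then for every $m$-tuple $\mathbf A=(A_1,\dots,A_m)$ of bounded self-adjoint operators on $\mathcal H$, $$\Lambda^{ess}_{p,q}(\mathbf A)=\bigcap\{\mathbf{cl}(\Lambda_{p,q}(A_1+G_1,\dots,A_m+G_m)) : G_1,\dots,G_m \text{ compact self-adjoint operators on } \mathcal H\}.$$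 -/

import Mathlib

open scoped Kronecker

noncomputable section

namespace MatricialRange

variable {H : Type*} [NormedAddCommGroup H] [InnerProductSpace ℂ H] [CompleteSpace H]

/-- The joint `(p,q)`-matricial range of an `m`-tuple of bounded operators: all tuples
`(B₁, …, Bₘ)` of `q × q` complex matrices such that, for one common isometry `X` from a
`pq`-dimensional Hilbert space into `H`, `X* Aⱼ X = I_p ⊗ Bⱼ` for every `j`.
The `pq`-dimensional domain of `X` is identified with `ℂ^p ⊗ ℂ^q`, by way of an orthonormal basis. -/
def jointRange (p q : ℕ) {m : ℕ} (A : Fin m → H →L[ℂ] H) :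
    Set (Fin m → Matrix (Fin q) (Fin q) ℂ) :=
  {B | ∃ X : EuclideanSpace ℂ (Fin p × Fin q) →L[ℂ] H,
      ContinuousLinearMap.adjoint X ∘L X =
        ContinuousLinearMap.id ℂ (EuclideanSpace ℂ (Fin p × Fin q)) ∧
      ∀ j, ContinuousLinearMap.adjoint X ∘L A j ∘L X =
        Matrix.toEuclideanCLM (𝕜 := ℂ) ((1 : Matrix (Fin p) (Fin p) ℂ) ⊗ₖ B j)}

/-- A bounded operator of finite rank: its range is finite dimensional. -/
def IsFiniteRank (F : H →L[ℂ] H) : Prop :=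
  FiniteDimensional ℂ (LinearMap.range (F : H →ₗ[ℂ] H))

/-- The joint essential `(p,q)`-matricial range: the intersection of the closures of the joint
`(p,q)`-matricial ranges of all perturbations of `A` by tuples of finite rank operators
(which need not be self-adjoint). -/
def essRange (p q : ℕ) {m : ℕ} (A : Fin m → H →L[ℂ] H) :
    Set (Fin m → Matrix (Fin q) (Fin q) ℂ) :=
  ⋂ F ∈ {F : Fin m → H →L[ℂ] H | ∀ j, IsFiniteRank (F j)}, closure (jointRange p q (A + F))

end MatricialRange

end

/-! Neither perturbation family contains the other, but both contain the self-adjoint finite rank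
tuples. Both intersections are identified with a third set, independent of `p`: the `C` with
`IsEssCompression A C`. Membership for all self-adjoint finite rank perturbations gives an essential
compression. One perturbation turns `A j` into `l j • P + Q A j Q`, with `P`, `Q` the projections on
`S`, `Sᗮ` and `l` in the joint essential numerical range. Isometries nearly compressing this to `C`
can have their `S`-part moved to remote vectors where `A j` acts almost as `l j`
(`of_block_diagonal`). Conversely, essential compressions survive compact perturbation
(`add_compact`). A Tverberg argument upgrades them to `p` mutually orthogonal isometries, orthogonal
to the ranges of any given finite rank tuple, with exactly equal compressions (`exists_isometries`).
-/

noncomputable section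

namespace MatricialRange

open ContinuousLinearMap
open scoped InnerProductSpace InnerProduct

/-! ### Disjoint convex combinations -/

/-- A weak form of Tverberg's theorem: finitely many points of a finite dimensional space, if there
are enough of them, admit `2 ^ n` convex combinations with disjoint supports and equal values. -/
theorem exists_disjoint_convex_combinations (W : Type*) [AddCommGroup W] [Module ℝ W]
    [FiniteDimensional ℝ W] (n : ℕ) :
    ∃ (ι κ : Type) (_ : Fintype ι) (_ : Fintype κ), Fintype.card κ = 2 ^ n ∧
      ∀ f : ι → W, ∃ (w : κ → ι → ℝ) (v : W), (∀ s i, 0 ≤ w s i) ∧ (∀ s, ∑ i, w s i = 1) ∧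
        (∀ s t, s ≠ t → ∀ i, w s i * w t i = 0) ∧ ∀ s, ∑ i, w s i • f i = v := by
  induction n with
  | zero =>
    refine ⟨Unit, Unit, inferInstance, inferInstance, by simp, fun f => ⟨fun _ _ => 1, f (), ?_⟩⟩
    simp
  | succ n ih =>
    obtain ⟨ι, κ, _, _, hκ, h⟩ := ih
    -- Radon step: the `d + 1` vectors `(v k, 1)` are dependent, so the points `v k` are affinely
    -- dependent. Splitting the dependence by sign doubles the number of combinations.
    set d := Module.finrank ℝ (W × ℝ) with hd
    refine ⟨Fin (d + 1) × ι, Bool × κ, inferInstance, inferInstance, ?_, fun f => ?_⟩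
    · simp [hκ, pow_succ, mul_comm]
    choose w v hw0 hw1 hwd hwv using fun k => h fun i => f (k, i)
    have hli : ¬ LinearIndependent ℝ fun k : Fin (d + 1) => ((v k, 1) : W × ℝ) := fun hl => by
      have := hl.fintype_card_le_finrank
      rw [Fintype.card_fin, ← hd] at this
      omega
    obtain ⟨c, hc, k₀, hk₀⟩ := Fintype.not_linearIndependent_iff.1 hli
    have hc1 : ∑ k, c k • v k = 0 := by simpa [Prod.fst_sum] using congrArg Prod.fst hc
    have hc2 : ∑ k, c k = 0 := by simpa [Prod.snd_sum] using congrArg Prod.snd hc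
    set s := ∑ k, max (c k) 0 with hs
    have hpm : ∀ x : ℝ, max x 0 - max (-x) 0 = x := fun x => by
      rcases le_total x 0 with hx | hx <;> simp [hx]
    have hs' : ∑ k, max (-c k) 0 = s := by
      have : ∑ k, (max (c k) 0 - max (-c k) 0) = 0 := by simpa only [hpm] using hc2
      rw [Finset.sum_sub_distrib] at this
      linarith
    have hspos : 0 < s := by
      rcases lt_or_gt_of_ne hk₀ with hk | hk
      · rw [← hs']
        exact Finset.sum_pos' (fun _ _ => le_max_right _ _) ⟨k₀, Finset.mem_univ _, by simp [hk]⟩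
      · exact Finset.sum_pos' (fun _ _ => le_max_right _ _) ⟨k₀, Finset.mem_univ _, by simp [hk]⟩
    let g : Bool → Fin (d + 1) → ℝ := fun b k => bif b then max (c k) 0 / s else max (-c k) 0 / s
    have hg0 : ∀ b k, 0 ≤ g b k := by
      rintro (_ | _) k <;> simp only [g, cond_true, cond_false] <;> positivity
    have hg1 : ∀ b, ∑ k, g b k = 1 := by
      rintro (_ | _) <;> simp only [g, cond_true, cond_false, ← Finset.sum_div]
      · rw [hs', div_self hspos.ne']
      · rw [← hs, div_self hspos.ne']
    have hgd : ∀ k, g true k * g false k = 0 := fun k => by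
      simp only [g, cond_true, cond_false]
      rcases le_total (c k) 0 with hx | hx <;> simp [hx]
    have hgv : ∑ k, g false k • v k = ∑ k, g true k • v k := by
      rw [← sub_eq_zero, ← Finset.sum_sub_distrib]
      have : ∀ k, g false k • v k - g true k • v k = (-s⁻¹) • c k • v k := fun k => by
        rw [← sub_smul, smul_smul]
        congr 1
        simp only [g, cond_true, cond_false]
        conv_rhs => rw [← hpm (c k)]
        field_simp
        ring
      rw [Finset.sum_congr rfl fun k _ => this k, ← Finset.smul_sum, hc1, smul_zero]
    refine ⟨fun bs ki => g bs.1 ki.1 * w ki.1 bs.2 ki.2, ∑ k, g true k • v k, ?_, ?_, ?_, ?_⟩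
    · exact fun _ _ => mul_nonneg (hg0 _ _) (hw0 _ _ _)
    · rintro ⟨b, t⟩
      simp only [Fintype.sum_prod_type, ← Finset.mul_sum, hw1, mul_one, hg1]
    · rintro ⟨b, t⟩ ⟨b', t'⟩ hne ⟨k, i⟩
      by_cases hb : b = b'
      · subst hb
        have : t ≠ t' := fun h => hne (by rw [h])
        have := hwd k t t' this i
        linear_combination (g b k * g b k) * this
      · have : g b k * g b' k = 0 := by
          have := hgd k
          cases b <;> cases b' <;> simp_all [mul_comm]
        linear_combination (w k t i * w k t' i) * this
    · rintro ⟨b, t⟩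
      simp only [Fintype.sum_prod_type, mul_smul, ← Finset.smul_sum, hwv]
      cases b
      · exact hgv
      · rfl

/-! ### Essential compressions -/

variable {H E : Type*} [NormedAddCommGroup H] [InnerProductSpace ℂ H] [CompleteSpace H]
  [NormedAddCommGroup E] [InnerProductSpace ℂ E] [CompleteSpace E]

theorem adjoint_comp_eq_zero_iff {F : Type*} [NormedAddCommGroup F] [InnerProductSpace ℂ F]
    {V : E →L[ℂ] H} {W : F →L[ℂ] H} :
    V† ∘L W = 0 ↔ ∀ x y, ⟪V x, W y⟫_ℂ = 0 := by
  constructor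
  · intro h x y
    rw [← adjoint_inner_right, ← comp_apply, h]
    simp
  · intro h
    ext y
    refine ext_inner_left ℂ fun x => ?_
    simpa [adjoint_inner_right] using h x y

theorem norm_le_one_of_adjoint_comp_self {V : E →L[ℂ] H} (hV : V† ∘L V = .id ℂ E) : ‖V‖ ≤ 1 := by
  refine opNorm_le_bound _ zero_le_one fun x => ?_
  rw [one_mul, norm_map_iff_adjoint_comp_self V |>.2 hV x]

theorem norm_conj_le {F : Type*} [NormedAddCommGroup F] [InnerProductSpace ℂ F] [CompleteSpace F]
    {V : E →L[ℂ] F} (hV : ‖V‖ ≤ 1) (T : F →L[ℂ] F) : ‖V† ∘L T ∘L V‖ ≤ ‖T‖ := by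
  calc ‖V† ∘L T ∘L V‖ ≤ ‖V†‖ * (‖T‖ * ‖V‖) :=
        (opNorm_comp_le _ _).trans (by gcongr; exact opNorm_comp_le _ _)
    _ ≤ 1 * (‖T‖ * 1) := by
        gcongr
        rwa [LinearIsometryEquiv.norm_map]
    _ = ‖T‖ := by ring

/-- The tuple `C` is, up to arbitrarily small errors, a compression of `A` to subspaces orthogonal
to any prescribed finite dimensional subspace. -/
def IsEssCompression {m : ℕ} (A : Fin m → H →L[ℂ] H) (C : Fin m → E →L[ℂ] E) : Prop :=
  ∀ S : Submodule ℂ H, FiniteDimensional ℂ S → ∀ ε : ℝ, 0 < ε → ∃ V : E →L[ℂ] H,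
    V† ∘L V = .id ℂ E ∧ (∀ x, V x ∈ Sᗮ) ∧ ∀ j, ‖V† ∘L A j ∘L V - C j‖ < ε

/-- Greedy choice: each new isometry avoids `S` and the ranges of the earlier `V` and `A j ∘L V`.
Self-adjointness makes the decoupling symmetric. -/
theorem IsEssCompression.exists_orthogonal_seq [FiniteDimensional ℂ E] {m : ℕ}
    {A : Fin m → H →L[ℂ] H} (hA : ∀ j, IsSelfAdjoint (A j)) {C : Fin m → E →L[ℂ] E}
    (h : IsEssCompression A C) (S : Submodule ℂ H) [FiniteDimensional ℂ S] {ε : ℝ} (hε : 0 < ε) :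
    ∃ V : ℕ → E →L[ℂ] H, (∀ k, (V k)† ∘L V k = .id ℂ E ∧ (∀ x, V k x ∈ Sᗮ) ∧
        ∀ j, ‖(V k)† ∘L A j ∘L V k - C j‖ < ε) ∧
      ∀ k l, k ≠ l → (V k)† ∘L V l = 0 ∧ ∀ j, (V k)† ∘L A j ∘L V l = 0 := by
  let r : (E →L[ℂ] H) → (E →L[ℂ] H) → Prop := fun V W =>
    V† ∘L W = 0 ∧ ∀ j, V† ∘L A j ∘L W = 0
  have hr : Std.Symm r := ⟨fun V W hVW => by
    refine ⟨?_, fun j => ?_⟩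
    · have := congrArg adjoint hVW.1
      simpa [adjoint_comp] using this
    · have := congrArg adjoint (hVW.2 j)
      simpa [adjoint_comp, (hA j).adjoint_eq, comp_assoc] using this⟩
  obtain ⟨V, hV, hVr⟩ := exists_seq_of_forall_finset_exists'
    (fun V : E →L[ℂ] H => V† ∘L V = .id ℂ E ∧ (∀ x, V x ∈ Sᗮ) ∧
        ∀ j, ‖V† ∘L A j ∘L V - C j‖ < ε) r fun s _ => by
      let T : Submodule ℂ H := S ⊔ ⨆ V : s, (LinearMap.range (V : E →L[ℂ] H).toLinearMap ⊔
        ⨆ j, LinearMap.range (A j ∘L (V : E →L[ℂ] H)).toLinearMap)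
      obtain ⟨W, hW, hWT, hWC⟩ := h T inferInstance ε hε
      refine ⟨W, ⟨hW, fun x => Submodule.orthogonal_le le_sup_left (hWT x), hWC⟩,
        fun V hV => ⟨adjoint_comp_eq_zero_iff.2 fun x y => ?_, fun j => ?_⟩⟩
      · refine (Submodule.mem_orthogonal _ _).1 (hWT y) _ ?_
        refine Submodule.mem_sup_right (Submodule.mem_iSup_of_mem ⟨V, hV⟩ ?_)
        exact Submodule.mem_sup_left ⟨x, rfl⟩
      · have : V† ∘L A j ∘L W = (A j ∘L V)† ∘L W := by
          rw [adjoint_comp, (hA j).adjoint_eq, comp_assoc]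
        rw [this]
        refine adjoint_comp_eq_zero_iff.2 fun x y => ?_
        refine (Submodule.mem_orthogonal _ _).1 (hWT y) _ ?_
        refine Submodule.mem_sup_right (Submodule.mem_iSup_of_mem ⟨V, hV⟩ ?_)
        exact Submodule.mem_sup_right (Submodule.mem_iSup_of_mem j ⟨x, rfl⟩)
  exact ⟨V, hV, fun k l hkl => hVr hkl⟩

theorem adjoint_sum_smul_comp_sum_smul {ι : Type*} [Fintype ι] {V : ι → E →L[ℂ] H}
    {B : H →L[ℂ] H} (h : ∀ i k, i ≠ k → (V i)† ∘L B ∘L V k = 0) (α β : ι → ℝ) :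
    (∑ i, (α i : ℂ) • V i)† ∘L B ∘L (∑ k, (β k : ℂ) • V k) =
      ∑ i, (α i * β i) • ((V i)† ∘L B ∘L V i) := by
  simp only [map_sum, map_smulₛₗ, Complex.conj_ofReal, comp_finsetSum, finsetSum_comp, comp_smul,
    smul_comp]
  refine Finset.sum_congr rfl fun i _ => ?_
  rw [Finset.sum_eq_single i]
  · rw [← Complex.coe_smul, Complex.ofReal_mul, mul_smul, smul_comm]
  · intro k _ hk
    simp [h k i hk]
  · simp

/-- Compressions along an orthogonal sequence only approximate `C`. Averaging them with disjoint
supports makes them exactly equal, as `I_p ⊗ D` requires, and balls are convex, so the error bound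
persists. -/
theorem IsEssCompression.exists_isometries [FiniteDimensional ℂ E] {m : ℕ}
    {A : Fin m → H →L[ℂ] H} (hA : ∀ j, IsSelfAdjoint (A j)) {C : Fin m → E →L[ℂ] E}
    (h : IsEssCompression A C) (p : ℕ) (S : Submodule ℂ H) [FiniteDimensional ℂ S] {ε : ℝ}
    (hε : 0 < ε) :
    ∃ (U : Fin p → E →L[ℂ] H) (D : Fin m → E →L[ℂ] E), (∀ a x, U a x ∈ Sᗮ) ∧
      (∀ a, (U a)† ∘L U a = .id ℂ E) ∧ (∀ a b, a ≠ b → (U a)† ∘L U b = 0) ∧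
      (∀ a j, (U a)† ∘L A j ∘L U a = D j) ∧ (∀ a b, a ≠ b → ∀ j, (U a)† ∘L A j ∘L U b = 0) ∧
      ∀ j, ‖D j - C j‖ < ε := by
  obtain ⟨V, hV, hVo⟩ := h.exists_orthogonal_seq hA S hε
  obtain ⟨ι, κ, _, _, hκ, hT⟩ := exists_disjoint_convex_combinations (Fin m → E →L[ℂ] E) p
  obtain ⟨e⟩ : Nonempty (ι ↪ ℕ) := ⟨(Fintype.equivFin ι).toEmbedding.trans Fin.valEmbedding⟩
  obtain ⟨g⟩ : Nonempty (Fin p ↪ κ) := Function.Embedding.nonempty_of_card_le (by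
    rw [hκ, Fintype.card_fin]; exact Nat.lt_two_pow_self.le)
  obtain ⟨w, D, hw0, hw1, hwd, hwD⟩ := hT fun i j => (V (e i))† ∘L A j ∘L V (e i)
  -- Square roots of the weights: cross terms vanish, so compressing by `U s` averages the
  -- compressions with weights `w s`.
  let U : κ → E →L[ℂ] H := fun s => ∑ i, (√(w s i) : ℂ) • V (e i)
  have hU (B : H →L[ℂ] H) (hB : ∀ i k, i ≠ k → (V i)† ∘L B ∘L V k = 0) (s t : κ) :
      (U s)† ∘L B ∘L U t = ∑ i, √(w s i * w t i) • ((V (e i))† ∘L B ∘L V (e i)) := by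
    simp only [U]
    rw [adjoint_sum_smul_comp_sum_smul fun i k hik => hB _ _ (e.injective.ne hik)]
    simp only [Real.sqrt_mul (hw0 _ _)]
  have hU0 (B : H →L[ℂ] H) (hB : ∀ i k, i ≠ k → (V i)† ∘L B ∘L V k = 0) (s t : κ) (hst : s ≠ t) :
      (U s)† ∘L B ∘L U t = 0 := by
    rw [hU B hB]
    simp [hwd s t hst]
  have hU1 (B : H →L[ℂ] H) (hB : ∀ i k, i ≠ k → (V i)† ∘L B ∘L V k = 0) (s : κ) :
      (U s)† ∘L B ∘L U s = ∑ i, w s i • ((V (e i))† ∘L B ∘L V (e i)) := by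
    rw [hU B hB]
    simp [Real.sqrt_mul_self (hw0 _ _)]
  have hD (s : κ) (j : Fin m) : (U s)† ∘L A j ∘L U s = D j := by
    rw [hU1 _ fun i k hik => (hVo i k hik).2 j, ← hwD s, Finset.sum_apply]
    rfl
  have hid : ∀ i k, i ≠ k → (V i)† ∘L .id ℂ H ∘L V k = 0 := fun i k hik => by
    simpa using (hVo i k hik).1
  refine ⟨fun a => U (g a), D, fun a x => ?_, fun a => ?_, fun a b hab => ?_, fun a j => hD _ j,
    fun a b hab j => hU0 _ (fun i k hik => (hVo i k hik).2 j) _ _ (g.injective.ne hab), fun j => ?_⟩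
  · simp only [U, sum_apply, smul_apply]
    exact Submodule.sum_mem _ fun i _ => Submodule.smul_mem _ _ ((hV (e i)).2.1 x)
  · have := hU1 _ hid (g a)
    simp only [id_comp, (hV _).1, ← Finset.sum_smul, hw1, one_smul] at this
    exact this
  · simpa using hU0 _ hid (g a) (g b) (g.injective.ne hab)
  · obtain ⟨s⟩ : Nonempty κ := Fintype.card_pos_iff.1 (by rw [hκ]; positivity)
    rw [← hwD s, ← mem_ball_iff_norm, Finset.sum_apply]
    refine (convex_ball (C j) ε).sum_mem (fun i _ => hw0 s i) (hw1 s) fun i _ => ?_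
    rw [mem_ball_iff_norm]
    exact (hV (e i)).2.2 j

/-- A compact operator maps the unit ball close to a finite set; isometries orthogonal to that set
make its compression small. -/
theorem IsEssCompression.add_compact {m : ℕ} {A K : Fin m → H →L[ℂ] H}
    (hK : ∀ j, IsCompactOperator (K j)) {C : Fin m → E →L[ℂ] E} (h : IsEssCompression A C) :
    IsEssCompression (A + K) C := by
  intro S _ ε hε
  have hnet (j : Fin m) : ∃ t : Set H, t.Finite ∧
      ∀ x, ‖x‖ ≤ 1 → ∃ y ∈ t, ‖K j x - y‖ < ε / 2 := by
    have hc := (IsCompactOperator.isCompact_closure_image_closedBall (f := (K j).toLinearMap)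
      (hK j) 1).totallyBounded
    obtain ⟨t, ht, hsub⟩ := Metric.totallyBounded_iff.1 hc (ε / 2) (half_pos hε)
    refine ⟨t, ht, fun x hx => ?_⟩
    have := hsub (subset_closure ⟨x, by simpa using hx, rfl⟩)
    simpa [dist_eq_norm] using this
  choose t ht hnet using hnet
  have hfin (j : Fin m) : FiniteDimensional ℂ (Submodule.span ℂ (t j)) :=
    FiniteDimensional.span_of_finite ℂ (ht j)
  obtain ⟨V, hV, hVS, hVC⟩ := h (S ⊔ ⨆ j, Submodule.span ℂ (t j)) inferInstance _ (half_pos hε)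
  refine ⟨V, hV, fun x => Submodule.orthogonal_le le_sup_left (hVS x), fun j => ?_⟩
  have hVt : ∀ y ∈ t j, (V†) y = 0 := fun y hy => by
    refine ext_inner_right ℂ fun x => ?_
    rw [adjoint_inner_left, inner_zero_left]
    exact (Submodule.mem_orthogonal _ _).1 (hVS x) _
      (Submodule.mem_sup_right (Submodule.mem_iSup_of_mem j (Submodule.subset_span hy)))
  have hV1 := norm_le_one_of_adjoint_comp_self hV
  have hKV : ‖V† ∘L K j ∘L V‖ ≤ ε / 2 := by
    refine opNorm_le_of_unit_norm (half_pos hε).le fun x hx => ?_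
    obtain ⟨y, hy, hxy⟩ := hnet j (V x) ((V.le_opNorm x).trans (by rw [hx, mul_one]; exact hV1))
    have : (V† ∘L K j ∘L V) x = (V†) (K j (V x) - y) := by simp [hVt y hy]
    rw [this]
    calc ‖(V†) (K j (V x) - y)‖ ≤ ‖V†‖ * ‖K j (V x) - y‖ := le_opNorm _ _
      _ ≤ 1 * (ε / 2) := by
        gcongr
        rwa [LinearIsometryEquiv.norm_map]
      _ = ε / 2 := one_mul _
  have : V† ∘L (A + K) j ∘L V - C j = (V† ∘L A j ∘L V - C j) + V† ∘L K j ∘L V := by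
    simp only [Pi.add_apply, add_comp, comp_add]
    abel
  rw [this]
  calc _ ≤ _ := norm_add_le _ _
    _ < ε / 2 + ε / 2 := add_lt_add_of_lt_of_le (hVC j) hKV
    _ = ε := add_halves ε

/-! ### Essential numerical range and block diagonal perturbations -/

/-- The joint essential numerical range of self-adjoint operators is nonempty. -/
theorem exists_isEssCompression_scalar (hH : ¬ FiniteDimensional ℂ H) {m : ℕ}
    {A : Fin m → H →L[ℂ] H} (hA : ∀ j, IsSelfAdjoint (A j)) :
    ∃ l : Fin m → ℝ, IsEssCompression A fun j => (l j : ℂ) • ContinuousLinearMap.id ℂ ℂ := by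
  let num : H → Fin m → ℝ := fun x j => (⟪x, A j x⟫_ℂ).re
  let t : {S : Submodule ℂ H // FiniteDimensional ℂ S} → Set (Fin m → ℝ) := fun S =>
    closure (num '' {x | x ∈ S.1ᗮ ∧ ‖x‖ = 1})
  have hbdd (S : Submodule ℂ H) : num '' {x | x ∈ S ∧ ‖x‖ = 1} ⊆
      Set.pi Set.univ fun j => Metric.closedBall 0 ‖A j‖ := by
    rintro _ ⟨x, ⟨-, hx⟩, rfl⟩ j -
    rw [mem_closedBall_zero_iff, Real.norm_eq_abs]
    calc |(⟪x, A j x⟫_ℂ).re| ≤ ‖⟪x, A j x⟫_ℂ‖ := Complex.abs_re_le_norm _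
      _ ≤ ‖x‖ * ‖A j x‖ := norm_inner_le_norm _ _
      _ ≤ ‖x‖ * (‖A j‖ * ‖x‖) := by gcongr; exact le_opNorm _ _
      _ = ‖A j‖ := by simp [hx]
  have hcpt : IsCompact (Set.pi Set.univ fun j => Metric.closedBall (0 : ℝ) ‖A j‖) :=
    isCompact_univ_pi fun j => isCompact_closedBall _ _
  have : Nonempty {S : Submodule ℂ H // FiniteDimensional ℂ S} := ⟨⟨⊥, inferInstance⟩⟩
  -- Compactness over a directed family; infinite dimension keeps each `Sᗮ` nonzero.
  obtain ⟨l, hl⟩ := IsCompact.nonempty_iInter_of_directed_nonempty_isCompact_isClosed t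
    (fun S T => by
      have := S.2
      have := T.2
      refine ⟨⟨S.1 ⊔ T.1, inferInstance⟩, ?_, ?_⟩ <;>
      refine closure_mono (Set.image_mono fun x hx => ⟨Submodule.orthogonal_le ?_ hx.1, hx.2⟩)
      exacts [le_sup_left, le_sup_right])
    (fun S => by
      have := S.2
      have hne : S.1ᗮ ≠ ⊥ := fun hbot => by
        rw [Submodule.orthogonal_eq_bot_iff] at hbot
        have h := S.2
        rw [hbot] at h
        exact hH (Module.Finite.equiv (Submodule.topEquiv (R := ℂ) (M := H)))
      obtain ⟨x, hx, hx0⟩ := Submodule.exists_mem_ne_zero_of_ne_bot hne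
      refine Set.Nonempty.closure ⟨_, (‖x‖⁻¹ : ℂ) • x, ⟨Submodule.smul_mem _ _ hx, ?_⟩, rfl⟩
      rw [norm_smul]
      simp [hx0])
    (fun S => (hcpt.closure_of_subset (hbdd _)))
    (fun S => isClosed_closure)
  refine ⟨l, fun S hS ε hε => ?_⟩
  obtain ⟨_, ⟨x, ⟨hxS, hx1⟩, rfl⟩, hxl⟩ :=
    Metric.mem_closure_iff.1 (Set.mem_iInter.1 hl ⟨S, hS⟩) ε hε
  refine ⟨toSpanSingleton ℂ x, ?_, fun c => ?_, fun j => ?_⟩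
  · refine (norm_map_iff_adjoint_comp_self _).1 fun c => ?_
    rw [toSpanSingleton_apply, norm_smul, hx1, mul_one]
  · exact Submodule.smul_mem _ _ hxS
  · have hre : ((⟪x, A j x⟫_ℂ).re : ℂ) = ⟪x, A j x⟫_ℂ := by
      rw [← Complex.conj_eq_iff_re, inner_conj_symm, ← adjoint_inner_right, (hA j).adjoint_eq]
    have : (toSpanSingleton ℂ x)† ∘L A j ∘L toSpanSingleton ℂ x -
        (l j : ℂ) • ContinuousLinearMap.id ℂ ℂ =
          ((num x j - l j : ℝ) : ℂ) • ContinuousLinearMap.id ℂ ℂ := by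
      ext
      have : ((toSpanSingleton ℂ x)†) (A j x) = ⟪x, A j x⟫_ℂ := by
        have := adjoint_inner_right (toSpanSingleton ℂ x) (1 : ℂ) (A j x)
        simpa using this
      simp [this, num, hre]
    rw [this, norm_smul, Complex.norm_real, norm_id, mul_one, ← dist_eq_norm, dist_comm]
    exact (dist_le_pi_dist _ _ j).trans_lt hxl

/-- If `C` is, for every finite dimensional `S`, a limit of compressions of the block diagonal
operators `l j ⊕ (compression of A j to Sᗮ)`, then it is an essential compression of `A`. -/
theorem IsEssCompression.of_block_diagonal [FiniteDimensional ℂ E] {m : ℕ}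
    {A : Fin m → H →L[ℂ] H} (hA : ∀ j, IsSelfAdjoint (A j)) {l : Fin m → ℝ}
    (hl : IsEssCompression A fun j => (l j : ℂ) • ContinuousLinearMap.id ℂ ℂ)
    {C : Fin m → E →L[ℂ] E}
    (h : ∀ (S : Submodule ℂ H) [FiniteDimensional ℂ S], ∀ ε : ℝ, 0 < ε → ∃ V : E →L[ℂ] H,
      V† ∘L V = .id ℂ E ∧ ∀ j, ‖V† ∘L ((l j : ℂ) • S.starProjection +
        Sᗮ.starProjection ∘L A j ∘L Sᗮ.starProjection) ∘L V - C j‖ < ε) :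
    IsEssCompression A C := by
  intro S _ ε hε
  obtain ⟨V, hV, hVC⟩ := h S (ε / 2) (half_pos hε)
  set P := S.starProjection with hP
  set Q := Sᗮ.starProjection with hQ
  have hPQ : P + Q = .id ℂ H := 
    (Submodule.id_eq_sum_starProjection_self_orthogonalComplement (K := S)).symm
  have hPa : P† = P := (isSelfAdjoint_starProjection S).adjoint_eq
  have hQa : Q† = Q := (isSelfAdjoint_starProjection Sᗮ).adjoint_eq
  have hQQ : Q ∘L Q = Q := Submodule.isIdempotentElem_starProjection Sᗮ
  let b := stdOrthonormalBasis ℂ S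
  set n := Module.finrank ℂ S with hn
  let T : Submodule ℂ H := S ⊔ (LinearMap.range (Q ∘L V).toLinearMap ⊔
    ⨆ j, LinearMap.range (A j ∘L Q ∘L V).toLinearMap)
  -- The `n` errors, one per basis vector of `S`, add up to at most `ε / 2`; the `+ 1` covers `S =
  -- ⊥`.
  obtain ⟨X, hX, hXo⟩ := hl.exists_orthogonal_seq hA T
    (show 0 < ε / (2 * (n + 1)) by positivity)
  let β : Fin n → H →L[ℂ] ℂ := fun k => innerSL ℂ (b k : H)
  have hβP : ∑ k, (β k)† ∘L β k = P := by
    rw [hP, b.starProjection_eq_sum_rankOne]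
    refine Finset.sum_congr rfl fun k _ => ?_
    ext x
    refine ext_inner_left ℂ fun y => ?_
    simp [β, adjoint_inner_right, inner_smul_right, mul_comm]
  have hβ1 (k) : ‖β k‖ ≤ 1 := by
    simp only [β, innerSL_apply_norm]
    exact (b.norm_eq_one k).le
  -- Partial isometry from `S` into `Tᗮ`. The choice of `T` kills all cross terms between `J ∘L V`
  -- and `Q ∘L V`.
  let J : H →L[ℂ] H := ∑ k : Fin n, X k ∘L β k
  have hJT (x) : J x ∈ Tᗮ := by
    simp only [J, sum_apply, comp_apply]
    exact Submodule.sum_mem _ fun k _ => (hX k).2.1 _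
  have hJ0 (W : E →L[ℂ] H) (hW : ∀ x, W x ∈ T) : J† ∘L W = 0 :=
    adjoint_comp_eq_zero_iff.2 fun x y => (Submodule.mem_orthogonal' _ _).1 (hJT x) _ (hW y)
  have hJQ : J† ∘L Q ∘L V = 0 := hJ0 _ fun x =>
    Submodule.mem_sup_right (Submodule.mem_sup_left ⟨x, rfl⟩)
  have hJAQ (j) : J† ∘L A j ∘L Q ∘L V = 0 := hJ0 _ fun x =>
    Submodule.mem_sup_right (Submodule.mem_sup_right (Submodule.mem_iSup_of_mem j ⟨x, rfl⟩))
  have hJconj (B : H →L[ℂ] H) (hB : ∀ i k, i ≠ k → (X i)† ∘L B ∘L X k = 0) :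
      J† ∘L B ∘L J = ∑ k : Fin n, (β k)† ∘L ((X k)† ∘L B ∘L X k) ∘L β k := by
    simp only [J, map_sum, comp_finsetSum, finsetSum_comp, adjoint_comp]
    refine Finset.sum_congr rfl fun i _ => ?_
    rw [Finset.sum_eq_single i]
    · simp only [comp_assoc]
    · intro k _ hk
      have := hB k i (Fin.val_injective.ne hk)
      calc _ = (β k)† ∘L ((X k)† ∘L B ∘L X i) ∘L β i := by simp only [comp_assoc]
        _ = 0 := by rw [this]; simp
    · simp
  have hJJ : J† ∘L J = P := by
    have := hJconj (.id ℂ H) fun i k hik => by simpa using (hXo i k hik).1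
    simpa [(hX _).1, hβP] using this
  have hJA (j) : ‖J† ∘L A j ∘L J - (l j : ℂ) • P‖ ≤ ε / 2 := by
    rw [hJconj _ fun i k hik => (hXo i k hik).2 j, ← hβP, Finset.smul_sum,
      ← Finset.sum_sub_distrib]
    have (k : Fin n) : ‖(β k)† ∘L ((X k)† ∘L A j ∘L X k) ∘L β k - (l j : ℂ) • (β k)† ∘L β k‖ ≤
        ε / (2 * (n + 1)) := by
      have : (β k)† ∘L ((X k)† ∘L A j ∘L X k) ∘L β k - (l j : ℂ) • (β k)† ∘L β k =
          (β k)† ∘L ((X k)† ∘L A j ∘L X k - (l j : ℂ) • ContinuousLinearMap.id ℂ ℂ) ∘L β k := by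
        simp [sub_comp, comp_sub, smul_comp, comp_smul]
      rw [this]
      exact (norm_conj_le (hβ1 k) _).trans ((hX k).2.2 j).le
    calc _ ≤ _ := norm_sum_le _ _
      _ ≤ ∑ _k : Fin n, ε / (2 * (n + 1)) := Finset.sum_le_sum fun k _ => this k
      _ = ε / 2 * (n / (n + 1)) := by
        rw [Finset.sum_const, Finset.card_univ, Fintype.card_fin, nsmul_eq_mul]
        field_simp
      _ ≤ ε / 2 * 1 := by
        gcongr
        rw [div_le_one (by positivity)]
        linarith
      _ = ε / 2 := mul_one _
  have hV1 := norm_le_one_of_adjoint_comp_self hV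
  have hQJ : (Q ∘L V)† ∘L J = 0 := by
    simpa [adjoint_comp, comp_assoc] using congrArg adjoint hJQ
  have hQAJ (j) : (Q ∘L V)† ∘L A j ∘L J = 0 := by
    simpa [adjoint_comp, comp_assoc, (hA j).adjoint_eq] using congrArg adjoint (hJAQ j)
  have hconj (B : H →L[ℂ] H) (h1 : J† ∘L B ∘L Q ∘L V = 0) (h2 : (Q ∘L V)† ∘L B ∘L J = 0) :
      (J ∘L V + Q ∘L V)† ∘L B ∘L (J ∘L V + Q ∘L V) =
        V† ∘L (J† ∘L B ∘L J + Q ∘L B ∘L Q) ∘L V := by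
    have h1' : V† ∘L J† ∘L B ∘L Q ∘L V = 0 := by rw [h1, comp_zero]
    have h2' : V† ∘L Q ∘L B ∘L J ∘L V = 0 := by
      have := congrArg (· ∘L V) h2
      simpa only [adjoint_comp, hQa, comp_assoc, zero_comp] using this
    simp only [map_add, adjoint_comp, hQa, comp_add, add_comp, comp_assoc, h1', h2']
    abel
  refine ⟨J ∘L V + Q ∘L V, ?_, fun x => ?_, fun j => ?_⟩
  · have := hconj (.id ℂ H) (by simpa using hJQ) (by simpa using hQJ)
    simp only [id_comp, hJJ, hQQ, hPQ, hV] at this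
    exact this
  · exact Submodule.add_mem _ (Submodule.orthogonal_le le_sup_left (hJT _))
      (Submodule.starProjection_apply_mem _ _)
  · rw [hconj _ (hJAQ j) (hQAJ j)]
    have : V† ∘L (J† ∘L A j ∘L J + Q ∘L A j ∘L Q) ∘L V - C j =
        (V† ∘L ((l j : ℂ) • P + Q ∘L A j ∘L Q) ∘L V - C j) +
          V† ∘L (J† ∘L A j ∘L J - (l j : ℂ) • P) ∘L V := by
      simp only [add_comp, comp_add, sub_comp, comp_sub]
      abel
    rw [this]
    calc _ ≤ _ := norm_add_le _ _
      _ < ε / 2 + ε / 2 := add_lt_add_of_lt_of_le (hVC j) ((norm_conj_le hV1 _).trans (hJA j))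
      _ = ε := add_halves ε

/-! ### Block decomposition of the joint range -/

/-- The projection of `ℂ^p ⊗ ℂ^q` onto its `a`-th block `ℂ^q`. -/
def blockProj (p q : ℕ) (a : Fin p) :
    EuclideanSpace ℂ (Fin p × Fin q) →L[ℂ] EuclideanSpace ℂ (Fin q) :=
  LinearMap.toContinuousLinearMap
    { toFun := fun v => WithLp.toLp 2 fun i => v (a, i)
      map_add' := fun _ _ => rfl
      map_smul' := fun _ _ => rfl }

@[simp]
theorem blockProj_apply {p q : ℕ} (a : Fin p) (v : EuclideanSpace ℂ (Fin p × Fin q)) (i : Fin q) :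
    blockProj p q a v i = v (a, i) := rfl

theorem inner_eq_sum_blockProj {p q : ℕ} (v w : EuclideanSpace ℂ (Fin p × Fin q)) :
    ⟪v, w⟫_ℂ = ∑ a, ⟪blockProj p q a v, blockProj p q a w⟫_ℂ := by
  simp [PiLp.inner_apply, Fintype.sum_prod_type]

theorem blockProj_toEuclideanCLM_one_kronecker {p q : ℕ} (a : Fin p)
    (M : Matrix (Fin q) (Fin q) ℂ) (v : EuclideanSpace ℂ (Fin p × Fin q)) :
    blockProj p q a (Matrix.toEuclideanCLM (𝕜 := ℂ) ((1 : Matrix (Fin p) (Fin p) ℂ) ⊗ₖ M) v) =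
      Matrix.toEuclideanCLM (𝕜 := ℂ) M (blockProj p q a v) := by
  ext i
  simp [Matrix.ofLp_toEuclideanCLM, Matrix.mulVec, dotProduct, Fintype.sum_prod_type,
    Matrix.one_apply, ite_mul, Finset.sum_ite_eq]

theorem adjoint_blockProj_comp {p q : ℕ} (a b : Fin p) :
    blockProj p q a ∘L (blockProj p q b)† = if a = b then .id ℂ _ else 0 := by
  ext v i
  have : (((blockProj p q b)†) v) (a, i) = if a = b then v i else 0 := by
    have := adjoint_inner_right (blockProj p q b) (EuclideanSpace.single (a, i) 1) v
    rw [EuclideanSpace.inner_single_left] at this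
    simp only [map_one, one_mul] at this
    rw [this]
    by_cases h : a = b
    · subst h
      have : blockProj p q a (EuclideanSpace.single (a, i) 1) = EuclideanSpace.single i 1 := by
        ext k
        simp
      simp [this, EuclideanSpace.inner_single_left]
    · have : blockProj p q b (EuclideanSpace.single (a, i) 1) = 0 := by
        ext k
        simp [Ne.symm h]
      simp [this, h]
  rw [comp_apply, blockProj_apply, this]
  split_ifs <;> simp

theorem adjoint_sum_comp_blockProj {p q : ℕ} {U : Fin p → EuclideanSpace ℂ (Fin q) →L[ℂ] H}
    {B : H →L[ℂ] H} {M : Matrix (Fin q) (Fin q) ℂ}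
    (h : ∀ a, (U a)† ∘L B ∘L U a = Matrix.toEuclideanCLM (𝕜 := ℂ) M)
    (h0 : ∀ a b, a ≠ b → (U a)† ∘L B ∘L U b = 0) :
    (∑ a, U a ∘L blockProj p q a)† ∘L B ∘L (∑ a, U a ∘L blockProj p q a) =
      Matrix.toEuclideanCLM (𝕜 := ℂ) ((1 : Matrix (Fin p) (Fin p) ℂ) ⊗ₖ M) := by
  refine ContinuousLinearMap.ext fun v => ext_inner_left ℂ fun w => ?_
  rw [inner_eq_sum_blockProj w (Matrix.toEuclideanCLM (𝕜 := ℂ) _ v), comp_apply,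
    adjoint_inner_right]
  simp only [blockProj_toEuclideanCLM_one_kronecker, comp_apply, sum_apply, map_sum, inner_sum,
    sum_inner]
  have key (a b) : ⟪U a (blockProj p q a w), B (U b (blockProj p q b v))⟫_ℂ =
      ⟪blockProj p q a w, ((U a)† ∘L B ∘L U b) (blockProj p q b v)⟫_ℂ := by
    simp [adjoint_inner_right]
  rw [Finset.sum_comm]
  refine Finset.sum_congr rfl fun a _ => ?_
  rw [Finset.sum_eq_single a]
  · rw [key, h]
  · intro b _ hb
    rw [key, h0 a b hb.symm]
    simp
  · simp

theorem mem_closure_jointRange {p q m : ℕ} {B : Fin m → H →L[ℂ] H}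
    {C : Fin m → Matrix (Fin q) (Fin q) ℂ}
    (h : ∀ ε : ℝ, 0 < ε → ∃ (U : Fin p → EuclideanSpace ℂ (Fin q) →L[ℂ] H)
      (D : Fin m → EuclideanSpace ℂ (Fin q) →L[ℂ] EuclideanSpace ℂ (Fin q)),
      (∀ a, (U a)† ∘L U a = .id ℂ _) ∧ (∀ a b, a ≠ b → (U a)† ∘L U b = 0) ∧
      (∀ a j, (U a)† ∘L B j ∘L U a = D j) ∧ (∀ a b, a ≠ b → ∀ j, (U a)† ∘L B j ∘L U b = 0) ∧
      ∀ j, ‖D j - Matrix.toEuclideanCLM (𝕜 := ℂ) (C j)‖ < ε) :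
    C ∈ closure (jointRange p q B) := by
  let Φ : (Fin m → EuclideanSpace ℂ (Fin q) →L[ℂ] EuclideanSpace ℂ (Fin q)) →
      Fin m → Matrix (Fin q) (Fin q) ℂ := fun D j => (Matrix.toEuclideanCLM (𝕜 := ℂ)).symm (D j)
  have hΦ : Continuous Φ := continuous_pi fun j =>
    (LinearMap.continuous_of_finiteDimensional
      ((Matrix.toEuclideanCLM (𝕜 := ℂ) (n := Fin q)).symm.toAlgEquiv.toLinearMap)).comp
      (continuous_apply j)
  have hC : C = Φ fun j => Matrix.toEuclideanCLM (𝕜 := ℂ) (C j) := by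
    ext1 j
    simp [Φ]
  rw [hC]
  refine map_mem_closure hΦ (s := Φ ⁻¹' jointRange p q B) ?_ fun _ hD => hD
  refine Metric.mem_closure_iff.2 fun ε hε => ?_
  obtain ⟨U, D, hU, hU0, hUD, hUD0, hD⟩ := h ε hε
  refine ⟨D, ⟨∑ a, U a ∘L blockProj p q a, ?_, fun j => ?_⟩, ?_⟩
  · have := adjoint_sum_comp_blockProj (B := .id ℂ H) (M := 1) (U := U)
      (fun a => by rw [id_comp, hU a, map_one]; rfl)
      (fun a b hab => by rw [id_comp, hU0 a b hab])
    rw [id_comp, Matrix.one_kronecker_one, map_one] at this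
    exact this
  · exact adjoint_sum_comp_blockProj (fun a => by simp [Φ, hUD a j]) fun a b hab => hUD0 a b hab j
  · rw [dist_comm, dist_pi_lt_iff hε]
    intro j
    rw [dist_eq_norm]
    exact hD j

theorem exists_isometry_of_mem_closure_jointRange {p q m : ℕ} (hp : 0 < p)
    {B : Fin m → H →L[ℂ] H} {C : Fin m → Matrix (Fin q) (Fin q) ℂ}
    (h : C ∈ closure (jointRange p q B)) {ε : ℝ} (hε : 0 < ε) :
    ∃ V : EuclideanSpace ℂ (Fin q) →L[ℂ] H, V† ∘L V = .id ℂ _ ∧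
      ∀ j, ‖V† ∘L B j ∘L V - Matrix.toEuclideanCLM (𝕜 := ℂ) (C j)‖ < ε := by
  let Φ : (Fin m → Matrix (Fin q) (Fin q) ℂ) →
      Fin m → EuclideanSpace ℂ (Fin q) →L[ℂ] EuclideanSpace ℂ (Fin q) :=
    fun D j => Matrix.toEuclideanCLM (𝕜 := ℂ) (D j)
  have hΦ : Continuous Φ := continuous_pi fun j =>
    (LinearMap.continuous_of_finiteDimensional
      ((Matrix.toEuclideanCLM (𝕜 := ℂ) (n := Fin q)).toAlgEquiv.toLinearMap)).comp
      (continuous_apply j)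
  obtain ⟨_, ⟨D, ⟨X, hX, hXD⟩, rfl⟩, hdist⟩ := Metric.mem_closure_iff.1
    (map_mem_closure hΦ h (Set.mapsTo_image Φ _)) ε hε
  let a : Fin p := ⟨0, hp⟩
  have hcompr (M : Matrix (Fin q) (Fin q) ℂ) :
      blockProj p q a ∘L Matrix.toEuclideanCLM (𝕜 := ℂ) ((1 : Matrix (Fin p) (Fin p) ℂ) ⊗ₖ M) ∘L
        (blockProj p q a)† = Matrix.toEuclideanCLM (𝕜 := ℂ) M := by
    ext1 v
    have := congrArg (fun T => T v) (adjoint_blockProj_comp (q := q) a a)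
    simp only [comp_apply, if_true, id_apply] at this
    simp only [comp_apply, blockProj_toEuclideanCLM_one_kronecker, this]
  refine ⟨X ∘L (blockProj p q a)†, ?_, fun j => ?_⟩
  · calc _ = blockProj p q a ∘L (X† ∘L X) ∘L (blockProj p q a)† := by
          simp only [adjoint_comp, adjoint_adjoint, comp_assoc]
      _ = _ := by rw [hX, id_comp, adjoint_blockProj_comp, if_pos rfl]
  · have : (X ∘L (blockProj p q a)†)† ∘L B j ∘L X ∘L (blockProj p q a)† =
        Matrix.toEuclideanCLM (𝕜 := ℂ) (D j) := by
      rw [← hcompr (D j), ← hXD j]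
      simp only [adjoint_comp, adjoint_adjoint, comp_assoc]
    rw [this, ← dist_eq_norm, dist_comm]
    exact (dist_le_pi_dist _ _ j).trans_lt hdist

/-! ### Both intersections as essential compressions -/

theorem IsFiniteRank.isCompactOperator {F : H →L[ℂ] H} (hF : IsFiniteRank F) :
    IsCompactOperator F := by
  have : FiniteDimensional ℂ (LinearMap.range (F : H →ₗ[ℂ] H)) := hF
  have : ProperSpace (LinearMap.range (F : H →ₗ[ℂ] H)) := FiniteDimensional.proper ℂ _
  have h := isCompactOperator_of_locallyCompactSpace_dom
    (F.codRestrict (LinearMap.range (F : H →ₗ[ℂ] H)) fun x => ⟨x, rfl⟩)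
  exact h.clm_comp (LinearMap.range (F : H →ₗ[ℂ] H)).subtypeL

/-- An essential compression of `A` lies in the closure of the joint range of each finite rank
perturbation of `A`. -/
theorem IsEssCompression.mem_closure_jointRange_add {p q m : ℕ} {A F : Fin m → H →L[ℂ] H}
    (hA : ∀ j, IsSelfAdjoint (A j)) (hF : ∀ j, IsFiniteRank (F j))
    {C : Fin m → Matrix (Fin q) (Fin q) ℂ}
    (h : IsEssCompression A fun j => Matrix.toEuclideanCLM (𝕜 := ℂ) (C j)) :
    C ∈ closure (jointRange p q (A + F)) := by
  have hfin (j) : FiniteDimensional ℂ (LinearMap.range (F j : H →ₗ[ℂ] H)) := hF j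
  refine mem_closure_jointRange fun ε hε => ?_
  obtain ⟨U, D, hUS, hU, hU0, hUD, hUD0, hD⟩ :=
    h.exists_isometries hA p (⨆ j, LinearMap.range (F j : H →ₗ[ℂ] H)) hε
  have hUF (a b j) : (U a)† ∘L F j ∘L U b = 0 := adjoint_comp_eq_zero_iff.2 fun x y =>
    (Submodule.mem_orthogonal' _ _).1 (hUS a x) _ (Submodule.mem_iSup_of_mem j ⟨_, rfl⟩)
  have hUAF (a b j) : (U a)† ∘L (A + F) j ∘L U b = (U a)† ∘L A j ∘L U b := by
    rw [Pi.add_apply, add_comp, comp_add, hUF, add_zero]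
  exact ⟨U, D, hU, hU0, fun a j => by rw [hUAF, hUD], fun a b hab j => by rw [hUAF, hUD0 a b hab],
    hD⟩

theorem isEssCompression_of_mem_closure_jointRange (hH : ¬ FiniteDimensional ℂ H) {p q m : ℕ}
    (hp : 0 < p) {A : Fin m → H →L[ℂ] H} (hA : ∀ j, IsSelfAdjoint (A j))
    {C : Fin m → Matrix (Fin q) (Fin q) ℂ}
    (h : ∀ G : Fin m → H →L[ℂ] H, (∀ j, IsSelfAdjoint (G j)) → (∀ j, IsFiniteRank (G j)) →
      C ∈ closure (jointRange p q (A + G))) :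
    IsEssCompression A fun j => Matrix.toEuclideanCLM (𝕜 := ℂ) (C j) := by
  obtain ⟨l, hl⟩ := exists_isEssCompression_scalar hH hA
  refine .of_block_diagonal hA hl fun S _ ε hε => ?_
  have hP := isSelfAdjoint_starProjection S
  have hQ := isSelfAdjoint_starProjection Sᗮ
  have hPQ : S.starProjection + Sᗮ.starProjection = .id ℂ H :=
    (Submodule.id_eq_sum_starProjection_self_orthogonalComplement (K := S)).symm
  have hQ' : Sᗮ.starProjection = .id ℂ H - S.starProjection := by rw [← hPQ]; abel
  let G : Fin m → H →L[ℂ] H := fun j => (l j : ℂ) • S.starProjection +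
    Sᗮ.starProjection ∘L A j ∘L Sᗮ.starProjection - A j
  have hGA : A + G = fun j => (l j : ℂ) • S.starProjection +
      Sᗮ.starProjection ∘L A j ∘L Sᗮ.starProjection := by
    ext1 j
    simp [G]
  have hmem := h G (fun j => ?_) (fun j => ?_)
  · rw [hGA] at hmem
    exact exists_isometry_of_mem_closure_jointRange hp hmem hε
  · refine .sub (.add (.smul ?_ hP) ?_) (hA j)
    · exact Complex.conj_ofReal _
    · rw [isSelfAdjoint_iff']
      simp only [adjoint_comp, hQ.adjoint_eq, (hA j).adjoint_eq, comp_assoc]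
  -- With `Q = 1 - P`, one has `Q A Q - A = -P A Q - A P`.
  · have hle : LinearMap.range (G j : H →ₗ[ℂ] H) ≤ S ⊔ S.map (A j : H →ₗ[ℂ] H) := by
      rintro _ ⟨x, rfl⟩
      have hx : G j x = S.starProjection ((l j : ℂ) • x - A j (Sᗮ.starProjection x)) +
          A j (-S.starProjection x) := by
        simp only [G, hQ', sub_apply, add_apply, smul_apply, comp_apply, id_apply, map_sub,
          map_smul, map_neg]
        abel
      change G j x ∈ _
      rw [hx]
      exact Submodule.add_mem_sup (Submodule.starProjection_apply_mem _ _)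
        ⟨_, neg_mem (Submodule.starProjection_apply_mem _ _), rfl⟩
    exact Submodule.finiteDimensional_of_le hle

end MatricialRange

end

theorem proposition4p6 {H : Type*} [NormedAddCommGroup H] [InnerProductSpace ℂ H]
    [CompleteSpace H] (hH : ¬ FiniteDimensional ℂ H) {m p q : ℕ} (hp : 0 < p) (hq : 0 < q)
    (A : Fin m → H →L[ℂ] H) (hA : ∀ j, IsSelfAdjoint (A j)) :
    MatricialRange.essRange p q A =
      ⋂ G ∈ {G : Fin m → H →L[ℂ] H | ∀ j, IsSelfAdjoint (G j) ∧ IsCompactOperator (G j)},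
        closure (MatricialRange.jointRange p q (A + G)) := by
  ext C
  simp only [MatricialRange.essRange, Set.mem_iInter, Set.mem_ofPred_eq]
  constructor
  · intro h G hG
    have hC := MatricialRange.isEssCompression_of_mem_closure_jointRange hH hp hA
      fun F _ hF => h F hF
    -- The compact part is absorbed into the operator tuple, leaving the zero finite rank
    -- perturbation.
    have hzero : ∀ j, MatricialRange.IsFiniteRank ((0 : Fin m → H →L[ℂ] H) j) := fun j => by
      change FiniteDimensional ℂ (LinearMap.range (0 : H →ₗ[ℂ] H))
      rw [LinearMap.range_zero]
      infer_instance
    have := (hC.add_compact fun j => (hG j).2).mem_closure_jointRange_add (p := p)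
      (fun j => (hA j).add (hG j).1) hzero
    rwa [add_zero] at this
  · intro h F hF
    exact (MatricialRange.isEssCompression_of_mem_closure_jointRange hH hp hA fun G hGs hGf =>
      h G fun j => ⟨hGs j, (hGf j).isCompactOperator⟩).mem_closure_jointRange_add hA hF
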